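/- **Theorem 3.3.** For every integer $n\ge 1$ let $Z_1,Z_2,Z_3,\dots$ (depending on $n$) be independent random variables, each uniformly distributed on $N_n=\{1,2,\dots,n\}$. For $j\in N_n$ let $$X_{nj}=\min\{i\ge 2 : Z_{i-1}=Z_i=j\}$$ be the waiting time until the pair $jj$ occurs as a run ($X_{nj}=\infty$ if it never occurs). Let $M_n^{(k)}$, $1\le k\le n$, be the $k$-th largest of $X_{n1},\dots,X_{nn}$, let $M_n=M_n^{(1)}=\max\{X_{n1},\dots,X_{nn}\}$, and for $1\le a\le n$ let $S_{n,a}$ be the waiting time until $a$ different pairs among $11,22,\dots,nn$ have occurred, i.e. the least $m$ such that $a$ of them occur as runs within $Z_1,\dots,Z_m$ ($\infty$ if there is no such $m$). Let $k$ be a fixed positive integer. Then $S_{n,n-k+1}=M_n^{(k)}$ for every $n\ge k$, and for every real $x$ $$\lim_{n\to\infty}P\{M_n^{(k)}\le n^2(x+\ln n)\}=e^{-e^{-x}}\sum_{s=0}^{k-1}\frac{e^{-sx}}{s!}.$$ In particular, the time $M_n=S_{n,n}$ until all $n$ pairs have occurred has asymptotically the Gumbel extreme value distribution: for every real $x$,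 $$\lim_{n\to\infty}P\{M_n\le n^2(x+\ln n)\}=e^{-e^{-x}}.$$ -/

import Mathlib

open MeasureTheory ProbabilityTheory Filter Topology

noncomputable section

namespace PairCollector

/-- The pair `jj` occurs as a run in the sequence `z 1, z 2, z 3, …` with second draw number `k`,
i.e. `z (k - 1) = z k = j`.  Draws are numbered from `1`, so `k ≥ 2`; the value `z 0` is ignored. -/
def PairAt (z : ℕ → ℕ) (j k : ℕ) : Prop :=
  2 ≤ k ∧ z (k - 1) = j ∧ z k = j

/-- The waiting time `X_j = min {k : z (k - 1) = z k = j}` for the pair `jj`;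
it is `⊤` if the pair never occurs. -/
def pairTime (z : ℕ → ℕ) (j : ℕ) : ℕ∞ :=
  ⨅ (k : ℕ) (_ : PairAt z j k), (k : ℕ∞)

/-- The `k`-th largest (`1 ≤ k ≤ n`, counted with multiplicity) of `x 1, …, x n`: the entry
number `k` of the list of these values sorted in decreasing order.  The value `0` is returned
when `n < k`. -/
def kthLargest (n k : ℕ) (x : ℕ → ℕ∞) : ℕ∞ :=
  (((Finset.Icc 1 n).val.map x).sort (· ≥ ·)).getD (k - 1) 0

/-- `M_n^{(k)}`: the `k`-th largest of the waiting times for the pairs `11, 22, …, nn`. -/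
def kthMaxTime (n k : ℕ) (z : ℕ → ℕ) : ℕ∞ :=
  kthLargest n k (pairTime z)

/-- `M_n`: the maximum of the waiting times for the pairs `11, 22, …, nn`. -/
def maxTime (n : ℕ) (z : ℕ → ℕ) : ℕ∞ :=
  (Finset.Icc 1 n).sup (pairTime z)

open Classical in
/-- The number of different pairs `jj`, `1 ≤ j ≤ n`, that occur within the first `m` draws. -/
def numPairs (n m : ℕ) (z : ℕ → ℕ) : ℕ :=
  ((Finset.Icc 1 n).filter (fun j => ∃ k ≤ m, PairAt z j k)).card

/-- `S_{n,a}`: the waiting time until `a` of the pairs `jj`, `1 ≤ j ≤ n`, have occurred;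
it is `⊤` if this never happens. -/
def collectTime (n a : ℕ) (z : ℕ → ℕ) : ℕ∞ :=
  ⨅ (m : ℕ) (_ : a ≤ numPairs n m z), (m : ℕ∞)

/-- `t ≤ u` for an extended natural number `t` and a real number `u`
(in particular `t` is finite). -/
def TimeLE (t : ℕ∞) (u : ℝ) : Prop :=
  ∃ m : ℕ, t = (m : ℕ∞) ∧ (m : ℝ) ≤ u

end PairCollector

end

/-! ### Deterministic part: order statistics, collecting times and missing pairs. -/

namespace PairCollector

/-! Let W be the number of pairs still missing after m = ⌊n²(x + ln n)⌋ draws. For every sequence of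
draws the k-th largest waiting time is at most m iff W < k, iff at least n + 1 - k pairs have
occurred. This gives the identity with the collecting time (`collectTime_eq_kthMaxTime`) and reduces
the limit law to P(W < k).

W is asymptotically Poisson with mean e^{-x}, by the method of moments. Its binomial moment E C(W,
r) equals C(n, r) p, where p = `avoidProb n r m` is the probability that r given pairs are all
avoided. It depends only on r and satisfies a linear recurrence of order two in m
(`measureReal_avoids`). Comparing with geometric sequences squeezes p between two r-th powers of
(e^{-x} + o(1))/n, so C(n, r) p → e^{-rx}/r! (`tendsto_choose_mul_avoidProb`).

Inclusion-exclusion writes P(W = s) as an alternating series in these moments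
(`measureReal_card_missing_eq`), and dominated convergence passes to the limit term by term
(`tendsto_tsum_choose_mul_avoidProb`). -/

theorem iInf_natCast_le_natCast_iff (p : ℕ → Prop) (m : ℕ) :
    (⨅ (k : ℕ) (_ : p k), (k : ℕ∞)) ≤ (m : ℕ∞) ↔ ∃ k ≤ m, p k := by
  constructor
  · intro h
    by_contra! hcon
    have hlow : ((m + 1 : ℕ) : ℕ∞) ≤ ⨅ (k : ℕ) (_ : p k), (k : ℕ∞) := by
      refine le_iInf₂ fun k hpk => ?_
      have : m < k := by
        by_contra! hle
        exact hcon k hle hpk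
      exact_mod_cast this
    have : ((m + 1 : ℕ) : ℕ∞) ≤ (m : ℕ∞) := hlow.trans h
    have : m + 1 ≤ m := by exact_mod_cast this
    omega
  · rintro ⟨k, hk, hpk⟩
    exact (iInf₂_le k hpk).trans (by exact_mod_cast hk)

theorem pairTime_le_iff (z : ℕ → ℕ) (j m : ℕ) :
    pairTime z j ≤ (m : ℕ∞) ↔ ∃ k ≤ m, PairAt z j k :=
  iInf_natCast_le_natCast_iff _ m

theorem numPairs_mono (n : ℕ) (z : ℕ → ℕ) {l m : ℕ} (h : l ≤ m) :
    numPairs n l z ≤ numPairs n m z := by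
  classical
  refine Finset.card_le_card fun j hj => ?_
  simp only [Finset.mem_filter] at hj ⊢
  obtain ⟨hj, k, hk, hp⟩ := hj
  exact ⟨hj, k, hk.trans h, hp⟩

theorem collectTime_le_iff (n a m : ℕ) (z : ℕ → ℕ) :
    collectTime n a z ≤ (m : ℕ∞) ↔ a ≤ numPairs n m z := by
  refine (iInf_natCast_le_natCast_iff _ m).trans ⟨?_, fun h => ⟨m, le_rfl, h⟩⟩
  rintro ⟨l, hl, h⟩
  exact h.trans (numPairs_mono n z hl)

/-- Induction on the list: a head at most `c` bounds every later entry, so the count is 0; a head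
above `c` adds one to the count and shifts the index by one. -/
theorem getElem_le_iff_countP_lt {α : Type*} [LinearOrder α] {l : List α}
    (hl : l.Pairwise (· ≥ ·)) (c : α) {i : ℕ} (hi : i < l.length) :
    l[i] ≤ c ↔ l.countP (fun y => decide (c < y)) ≤ i := by
  induction l generalizing i with
  | nil => simp at hi
  | cons b l ih =>
    rw [List.pairwise_cons] at hl
    rw [List.countP_cons]
    cases i with
    | zero =>
      simp only [List.getElem_cons_zero, nonpos_iff_eq_zero, Nat.add_eq_zero_iff]
      constructor
      · intro hb
        refine ⟨List.countP_eq_zero.2 fun y hy => ?_, by simpa using hb⟩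
        simpa using (hl.1 y hy).trans hb
      · rintro ⟨-, h⟩
        simpa using h
    | succ i =>
      simp only [List.length_cons, Nat.add_lt_add_iff_right] at hi
      simp only [List.getElem_cons_succ]
      rw [ih hl.2 hi]
      by_cases hb : c < b
      · simp [hb]
      · have h0 : l.countP (fun y => decide (c < y)) = 0 := by
          refine List.countP_eq_zero.2 fun y hy => ?_
          simpa using (hl.1 y hy).trans (not_lt.1 hb)
        simp [hb, h0]

theorem kthLargest_le_iff {n k : ℕ} (hk : 1 ≤ k) (hkn : k ≤ n) (x : ℕ → ℕ∞) (c : ℕ∞) :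
    kthLargest n k x ≤ c ↔ ((Finset.Icc 1 n).filter (fun j => c < x j)).card < k := by
  unfold kthLargest
  set s := (Finset.Icc 1 n).val.map x with hs
  have hlen : (s.sort (· ≥ ·)).length = n := by
    rw [Multiset.length_sort, hs, Multiset.card_map]
    simp
  have hi : k - 1 < (s.sort (· ≥ ·)).length := by omega
  have hcount : (s.sort (· ≥ ·)).countP (fun y => decide (c < y)) =
      ((Finset.Icc 1 n).filter (fun j => c < x j)).card := by
    rw [← Multiset.coe_countP (p := fun y => c < y), Multiset.sort_eq, hs, Multiset.countP_map]
    rfl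
  rw [List.getD_eq_getElem _ _ hi, getElem_le_iff_countP_lt (Multiset.pairwise_sort s _) c hi,
    hcount]
  omega

open Classical in
/-- The pairs `jj`, `1 ≤ j ≤ n`, that do not occur within the first `m` draws. -/
noncomputable def missing (n m : ℕ) (z : ℕ → ℕ) : Finset ℕ :=
  (Finset.Icc 1 n).filter (fun j => ∀ k ≤ m, ¬ PairAt z j k)

theorem mem_missing {n m j : ℕ} {z : ℕ → ℕ} :
    j ∈ missing n m z ↔ j ∈ Finset.Icc 1 n ∧ ∀ k ≤ m, ¬ PairAt z j k := by
  simp [missing]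

theorem card_missing_add_numPairs (n m : ℕ) (z : ℕ → ℕ) :
    (missing n m z).card + numPairs n m z = n := by
  classical
  have h := Finset.card_filter_add_card_filter_not (s := Finset.Icc 1 n)
    (fun j => ∃ k ≤ m, PairAt z j k)
  simp only [Nat.card_Icc, add_tsub_cancel_right, not_exists, not_and] at h
  unfold missing numPairs
  rw [add_comm]
  convert h using 3

theorem kthMaxTime_le_iff {n k : ℕ} (hk : 1 ≤ k) (hkn : k ≤ n) (m : ℕ) (z : ℕ → ℕ) :
    kthMaxTime n k z ≤ (m : ℕ∞) ↔ (missing n m z).card < k := by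
  classical
  have : (Finset.Icc 1 n).filter (fun j => (m : ℕ∞) < pairTime z j) = missing n m z := by
    ext j
    rw [Finset.mem_filter, mem_missing, ← not_le, pairTime_le_iff]
    simp
  rw [kthMaxTime, kthLargest_le_iff hk hkn, this]

theorem eq_of_forall_le_natCast_iff {a b : ℕ∞} (h : ∀ m : ℕ, a ≤ m ↔ b ≤ m) : a = b := by
  refine le_antisymm ?_ ?_
  · induction b using ENat.recTopCoe with
    | top => exact le_top
    | coe b => exact (h b).2 le_rfl
  · induction a using ENat.recTopCoe with
    | top => exact le_top
    | coe a => exact (h a).1 le_rfl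

theorem collectTime_eq_kthMaxTime {n k : ℕ} (hk : 1 ≤ k) (hkn : k ≤ n) (z : ℕ → ℕ) :
    collectTime n (n + 1 - k) z = kthMaxTime n k z := by
  refine eq_of_forall_le_natCast_iff fun m => ?_
  rw [collectTime_le_iff, kthMaxTime_le_iff hk hkn]
  have := card_missing_add_numPairs n m z
  omega

theorem kthMaxTime_one {n : ℕ} (hn : 1 ≤ n) (z : ℕ → ℕ) : kthMaxTime n 1 z = maxTime n z := by
  refine eq_of_forall_le_natCast_iff fun m => ?_
  rw [kthMaxTime_le_iff le_rfl hn, maxTime, Finset.sup_le_iff, Nat.lt_one_iff,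
    Finset.card_eq_zero, Finset.eq_empty_iff_forall_notMem]
  refine forall_congr' fun j => ?_
  rw [mem_missing, pairTime_le_iff]
  push Not
  rfl

theorem timeLE_iff {t : ℕ∞} {u : ℝ} (hu : 0 ≤ u) : TimeLE t u ↔ t ≤ ((⌊u⌋₊ : ℕ) : ℕ∞) := by
  constructor
  · rintro ⟨m, rfl, hm⟩
    exact_mod_cast Nat.le_floor hm
  · intro h
    lift t to ℕ using ne_top_of_le_ne_top (ENat.natCast_ne_top _) h
    exact ⟨t, rfl, (Nat.le_floor_iff hu).1 (by exact_mod_cast h)⟩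

end PairCollector

/-! ### Geometric bounds for the avoidance probability. -/

namespace PairCollector

/-- The probability that `r` given pairs among `11, 22, …, nn` do not occur in `m` draws. -/
noncomputable def avoidProb (n r : ℕ) : ℕ → ℝ
  | 0 => 1
  | 1 => 1
  | m + 2 => (1 - 1 / (n : ℝ)) * avoidProb n r (m + 1) + (n - r) / (n : ℝ) ^ 2 * avoidProb n r m

section Bounds

variable {n r : ℕ}

/-- The recurrence has nonnegative coefficients, so powers of q with q² ≤ (1 - 1/n)q + (n - r)/n²
stay below its solution. For q = 1 - δ the inequality reads δ² - (1 + 1/n)δ + r/n² ≤ 0, and δ = r/n²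
satisfies it. -/
theorem pow_le_avoidProb (hn : 1 ≤ n) (hr : r ≤ n) (m : ℕ) :
    (1 - (r : ℝ) / n ^ 2) ^ m ≤ avoidProb n r m := by
  have hn' : (1 : ℝ) ≤ n := by exact_mod_cast hn
  have hr' : (r : ℝ) ≤ n := by exact_mod_cast hr
  have h0 : (0 : ℝ) ≤ 1 - (r : ℝ) / n ^ 2 := by
    rw [sub_nonneg, div_le_one (by positivity)]
    nlinarith
  have key : (1 - (r : ℝ) / n ^ 2) ^ 2 ≤
      (1 - 1 / (n : ℝ)) * (1 - (r : ℝ) / n ^ 2) + (n - r) / (n : ℝ) ^ 2 := by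
    have : (1 - 1 / (n : ℝ)) * (1 - (r : ℝ) / n ^ 2) + (n - r) / (n : ℝ) ^ 2 -
        (1 - (r : ℝ) / n ^ 2) ^ 2 = r * (n - r) / n ^ 4 := by
      field_simp
      ring
    have : (0 : ℝ) ≤ r * (n - r) / n ^ 4 := by
      have : (0 : ℝ) ≤ n - r := sub_nonneg.2 hr'
      positivity
    linarith
  induction m using Nat.twoStepInduction with
  | zero => simp [avoidProb]
  | one =>
    simp only [pow_one, avoidProb, sub_le_self_iff]
    positivity
  | more m ih0 ih1 =>
    have h1 : (0 : ℝ) ≤ 1 - 1 / (n : ℝ) := by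
      rw [sub_nonneg, div_le_one (by positivity)]
      exact hn'
    have h2 : (0 : ℝ) ≤ (n - r) / (n : ℝ) ^ 2 := div_nonneg (sub_nonneg.2 hr') (by positivity)
    calc (1 - (r : ℝ) / n ^ 2) ^ (m + 2)
        = (1 - (r : ℝ) / n ^ 2) ^ 2 * (1 - (r : ℝ) / n ^ 2) ^ m := by ring
      _ ≤ ((1 - 1 / (n : ℝ)) * (1 - (r : ℝ) / n ^ 2) + (n - r) / (n : ℝ) ^ 2) *
          (1 - (r : ℝ) / n ^ 2) ^ m := by gcongr
      _ = (1 - 1 / (n : ℝ)) * (1 - (r : ℝ) / n ^ 2) ^ (m + 1) +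
          (n - r) / (n : ℝ) ^ 2 * (1 - (r : ℝ) / n ^ 2) ^ m := by ring
      _ ≤ _ := by
        rw [avoidProb]
        gcongr

theorem avoidProb_nonneg (hn : 1 ≤ n) (hr : r ≤ n) (m : ℕ) : 0 ≤ avoidProb n r m := by
  refine le_trans (pow_nonneg ?_ m) (pow_le_avoidProb hn hr m)
  have hn' : (1 : ℝ) ≤ n := by exact_mod_cast hn
  have hr' : (r : ℝ) ≤ n := by exact_mod_cast hr
  rw [sub_nonneg, div_le_one (by positivity)]
  nlinarith

/-- Here δ = r/(n(n + 1)) is the root of the linear part -(1 + 1/n)δ + r/n², so the reverse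
inequality holds with slack δ². The index is shifted because the value at 1 is still 1. -/
theorem avoidProb_succ_le_pow (hn : 1 ≤ n) (hr : r ≤ n) (m : ℕ) :
    avoidProb n r (m + 1) ≤ (1 - (r : ℝ) / (n * (n + 1))) ^ m := by
  have hn' : (1 : ℝ) ≤ n := by exact_mod_cast hn
  have hr' : (r : ℝ) ≤ n := by exact_mod_cast hr
  have h0 : (0 : ℝ) ≤ 1 - (r : ℝ) / (n * (n + 1)) := by
    rw [sub_nonneg, div_le_one (by positivity)]
    nlinarith
  have h1 : (0 : ℝ) ≤ 1 - 1 / (n : ℝ) := by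
    rw [sub_nonneg, div_le_one (by positivity)]
    exact hn'
  have h2 : (0 : ℝ) ≤ (n - r) / (n : ℝ) ^ 2 := div_nonneg (sub_nonneg.2 hr') (by positivity)
  have key : (1 - 1 / (n : ℝ)) * (1 - (r : ℝ) / (n * (n + 1))) + (n - r) / (n : ℝ) ^ 2 ≤
      (1 - (r : ℝ) / (n * (n + 1))) ^ 2 := by
    have : (1 - (r : ℝ) / (n * (n + 1))) ^ 2 -
        ((1 - 1 / (n : ℝ)) * (1 - (r : ℝ) / (n * (n + 1))) + (n - r) / (n : ℝ) ^ 2) =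
        ((r : ℝ) / (n * (n + 1))) ^ 2 := by
      field_simp
      ring
    have : (0 : ℝ) ≤ ((r : ℝ) / (n * (n + 1))) ^ 2 := by positivity
    linarith
  induction m using Nat.twoStepInduction with
  | zero => simp [avoidProb]
  | one =>
    have : avoidProb n r (1 + 1) = 1 - r / n ^ 2 := by
      simp only [avoidProb]
      field_simp
      ring
    rw [this, pow_one]
    gcongr
    nlinarith
  | more m ih0 ih1 =>
    calc avoidProb n r (m + 2 + 1)
        = (1 - 1 / (n : ℝ)) * avoidProb n r (m + 1 + 1) +
            (n - r) / (n : ℝ) ^ 2 * avoidProb n r (m + 1) := by rw [avoidProb]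
      _ ≤ (1 - 1 / (n : ℝ)) * (1 - (r : ℝ) / (n * (n + 1))) ^ (m + 1) +
            (n - r) / (n : ℝ) ^ 2 * (1 - (r : ℝ) / (n * (n + 1))) ^ m := by gcongr
      _ = ((1 - 1 / (n : ℝ)) * (1 - (r : ℝ) / (n * (n + 1))) + (n - r) / (n : ℝ) ^ 2) *
            (1 - (r : ℝ) / (n * (n + 1))) ^ m := by ring
      _ ≤ (1 - (r : ℝ) / (n * (n + 1))) ^ 2 * (1 - (r : ℝ) / (n * (n + 1))) ^ m := by gcongr
      _ = _ := by ring

end Bounds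

end PairCollector

/-! ### Avoidance events and their probabilities. -/

namespace PairCollector

theorem pairAt_congr {z z' : ℕ → ℕ} {m : ℕ} (h : ∀ i, 1 ≤ i → i ≤ m → z i = z' i) {j k : ℕ}
    (hk : k ≤ m) : PairAt z j k ↔ PairAt z' j k := by
  refine and_congr_right fun h2 => ?_
  rw [h (k - 1) (by omega) (by omega), h k (by omega) hk]

theorem missing_congr {z z' : ℕ → ℕ} {m : ℕ} (n : ℕ) (h : ∀ i, 1 ≤ i → i ≤ m → z i = z' i) :
    missing n m z = missing n m z' := by
  ext j
  simp only [mem_missing]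
  exact and_congr_right fun _ => forall₂_congr fun k hk => not_congr (pairAt_congr h hk)

/-- None of the pairs `jj` with `j ∈ T` occurs within the first `m` draws. -/
def Avoids (T : Finset ℕ) (m : ℕ) (z : ℕ → ℕ) : Prop :=
  ∀ j ∈ T, ∀ k ≤ m, ¬ PairAt z j k

theorem avoids_congr {z z' : ℕ → ℕ} {m : ℕ} (T : Finset ℕ)
    (h : ∀ i, 1 ≤ i → i ≤ m → z i = z' i) : Avoids T m z ↔ Avoids T m z' :=
  forall₂_congr fun _ _ => forall₂_congr fun _ hk => not_congr (pairAt_congr h hk)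

theorem avoids_of_le_one (T : Finset ℕ) {m : ℕ} (hm : m ≤ 1) (z : ℕ → ℕ) : Avoids T m z :=
  fun _ _ _ hk hp => absurd hp.1 (by omega)

theorem avoids_succ_succ_iff {T : Finset ℕ} {m : ℕ} {z : ℕ → ℕ} :
    Avoids T (m + 2) z ↔ Avoids T (m + 1) z ∧ ¬ (z (m + 1) ∈ T ∧ z (m + 2) = z (m + 1)) := by
  constructor
  · refine fun h => ⟨fun j hj k hk => h j hj k (by omega), fun ⟨h1, h2⟩ => ?_⟩
    exact h _ h1 (m + 2) le_rfl ⟨by omega, rfl, h2⟩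
  · rintro ⟨h, h'⟩ j hj k hk hp
    rcases Nat.lt_or_ge k (m + 2) with hlt | hge
    · exact h j hj k (by omega) hp
    · obtain rfl : k = m + 2 := by omega
      obtain ⟨-, h1, h2⟩ := hp
      have h1 : z (m + 1) = j := h1
      exact h' ⟨h1 ▸ hj, h2.trans h1.symm⟩

theorem avoids_succ_iff_of_notMem {T : Finset ℕ} {m : ℕ} {z : ℕ → ℕ} (hz : z (m + 1) ∉ T) :
    Avoids T (m + 1) z ↔ Avoids T m z := by
  refine ⟨fun h j hj k hk => h j hj k (by omega), fun h j hj k hk hp => ?_⟩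
  rcases Nat.lt_or_ge k (m + 1) with hlt | hge
  · exact h j hj k (by omega) hp
  · obtain rfl : k = m + 1 := by omega
    exact hz (hp.2.2 ▸ hj)

/-- A subset of `Finset.Icc 1 n` is avoided exactly when it lies inside the missing set, so both
sides count the `r`-subsets of that set. -/
theorem sum_powersetCard_avoids (n m r : ℕ) (z : ℕ → ℕ) [DecidablePred fun T => Avoids T m z] :
    ∑ T ∈ (Finset.Icc 1 n).powersetCard r, (if Avoids T m z then (1 : ℝ) else 0) =
      (missing n m z).card.choose r := by
  rw [← Finset.card_powersetCard, Finset.sum_boole]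
  congr 2
  ext T
  rw [Finset.mem_filter, Finset.mem_powersetCard, Finset.mem_powersetCard]
  simp only [Finset.subset_iff, mem_missing, Avoids]
  constructor
  · rintro ⟨⟨h1, h2⟩, h3⟩
    exact ⟨fun j hj => ⟨h1 hj, h3 j hj⟩, h2⟩
  · rintro ⟨h1, h2⟩
    exact ⟨⟨fun j hj => (h1 hj).1, h2⟩, fun j hj => (h1 hj).2⟩

theorem choose_card_missing_eq {Ω : Type*} (Z : ℕ → Ω → ℕ) (n m r : ℕ) :
    (fun ω => ((missing n m fun i => Z i ω).card.choose r : ℝ)) = fun ω =>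
      ∑ T ∈ (Finset.Icc 1 n).powersetCard r,
        {ω | Avoids T m fun i => Z i ω}.indicator (1 : Ω → ℝ) ω := by
  classical
  funext ω
  rw [← sum_powersetCard_avoids]
  simp [Set.indicator_apply]

section Probability

variable {Ω : Type*} [MeasurableSpace Ω] {μ : Measure Ω} {Z : ℕ → Ω → ℕ} {n : ℕ}

/-- Factoring through finitely many discrete coordinates yields measurability of such events and
their independence of the next draw. -/
theorem exists_preimage_eq_of_dependsOn {Ω : Type*} (Z : ℕ → Ω → ℕ) {Q : (ℕ → ℕ) → Prop} {m : ℕ}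
    (hQ : ∀ z z' : ℕ → ℕ, (∀ i, 1 ≤ i → i ≤ m → z i = z' i) → (Q z ↔ Q z')) :
    ∃ S : Set (Finset.range m → ℕ),
      {ω | Q fun i => Z i ω} = (fun ω (i : Finset.range m) => Z (i + 1) ω) ⁻¹' S := by
  refine ⟨{g | Q fun i => if h : i - 1 ∈ Finset.range m then g ⟨i - 1, h⟩ else 0}, ?_⟩
  ext ω
  refine hQ _ _ fun i h1 hm => ?_
  have h : i - 1 ∈ Finset.range m := Finset.mem_range.2 (by omega)
  simp only [h, dite_true]
  congr 1
  omega

theorem measurableSet_avoids (hZ : ∀ i, Measurable (Z i)) (T : Finset ℕ) (m : ℕ) :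
    MeasurableSet {ω | Avoids T m fun i => Z i ω} := by
  obtain ⟨S, hS⟩ := exists_preimage_eq_of_dependsOn Z fun z z' => avoids_congr (m := m) T
  rw [hS]
  exact (measurable_pi_lambda _ fun i => hZ _) (MeasurableSet.of_discrete)

theorem measureReal_inter_draw (hZ : ∀ i, Measurable (Z i))
    (hindep : iIndepFun (fun i => Z (i + 1)) μ) {Q : (ℕ → ℕ) → Prop} {m : ℕ}
    (hQ : ∀ z z' : ℕ → ℕ, (∀ i, 1 ≤ i → i ≤ m → z i = z' i) → (Q z ↔ Q z')) (B : Set ℕ) :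
    μ.real ({ω | Q fun i => Z i ω} ∩ Z (m + 1) ⁻¹' B) =
      μ.real {ω | Q fun i => Z i ω} * μ.real (Z (m + 1) ⁻¹' B) := by
  obtain ⟨S, hS⟩ := exists_preimage_eq_of_dependsOn Z hQ
  -- Index `i` of the family is draw `i + 1`, so these blocks are draws 1 to `m` and draw `m + 1`.
  have hi := hindep.indepFun_finset (Finset.range m) {m} (by simp) (fun i => hZ _)
  have hB : Z (m + 1) ⁻¹' B = (fun ω (i : ({m} : Finset ℕ)) => Z (i + 1) ω) ⁻¹'
      {g | g ⟨m, Finset.mem_singleton_self m⟩ ∈ B} := rfl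
  rw [hS, hB, measureReal_def, hi.measure_inter_preimage_eq_mul _ _ MeasurableSet.of_discrete
    MeasurableSet.of_discrete, ENNReal.toReal_mul]
  rfl

variable [IsProbabilityMeasure μ]

theorem measureReal_draw_mem (hZ : ∀ i, Measurable (Z i))
    (hunif : ∀ i, 1 ≤ i → ∀ j ∈ Finset.Icc 1 n, μ.real (Z i ⁻¹' {j}) = 1 / n)
    {T : Finset ℕ} (hT : T ⊆ Finset.Icc 1 n) {i : ℕ} (hi : 1 ≤ i) :
    μ.real (Z i ⁻¹' (T : Set ℕ)) = T.card / n := by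
  have : Z i ⁻¹' (T : Set ℕ) = ⋃ j ∈ T, Z i ⁻¹' {j} := by ext; simp
  rw [this, measureReal_biUnion_finset _ fun j _ => hZ i (measurableSet_singleton j),
    Finset.sum_congr rfl fun j hj => hunif i hi j (hT hj)]
  · simp [div_eq_mul_inv]
  · intro a _ b _ hab
    refine Set.disjoint_left.2 fun ω ha hb => hab ?_
    exact ha.symm.trans hb

/-- Avoidance fails at draw m + 2 only if draw m + 1 lies in `T` and is repeated, which has
conditional probability 1/n. If draw m + 1 lies outside `T`, avoidance up to m + 1 is avoidance up
to m, independent of that draw. Writing a(m) for the probability, a(m+2) = a(m+1) - (a(m+1) - (1 -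
r/n)a(m))/n with r = `T.card`. -/
theorem measureReal_avoids (hn : 1 ≤ n) (hZ : ∀ i, Measurable (Z i))
    (hindep : iIndepFun (fun i => Z (i + 1)) μ)
    (hunif : ∀ i, 1 ≤ i → ∀ j ∈ Finset.Icc 1 n, μ.real (Z i ⁻¹' {j}) = 1 / n)
    {T : Finset ℕ} (hT : T ⊆ Finset.Icc 1 n) (m : ℕ) :
    μ.real {ω | Avoids T m fun i => Z i ω} = avoidProb n T.card m := by
  induction m using Nat.twoStepInduction with
  | zero =>
    have : {ω | Avoids T 0 fun i => Z i ω} = Set.univ :=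
      Set.eq_univ_of_forall fun ω => avoids_of_le_one T (by norm_num) _
    simp [this, avoidProb]
  | one =>
    have : {ω | Avoids T 1 fun i => Z i ω} = Set.univ :=
      Set.eq_univ_of_forall fun ω => avoids_of_le_one T le_rfl _
    simp [this, avoidProb]
  | more m ih0 ih1 =>
    have hn' : (n : ℝ) ≠ 0 := by positivity
    set A := fun m => {ω | Avoids T m fun i => Z i ω} with hA
    have hAm : ∀ m, MeasurableSet (A m) := measurableSet_avoids hZ T
    have hmemT : MeasurableSet (Z (m + 1) ⁻¹' (T : Set ℕ)) := hZ _ MeasurableSet.of_discrete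
    have hcompl : μ.real (Z (m + 1) ⁻¹' (T : Set ℕ)ᶜ) = 1 - T.card / n := by
      rw [Set.preimage_compl, probReal_compl_eq_one_sub hmemT,
        measureReal_draw_mem hZ hunif hT (by omega)]
    have hout : μ.real (A (m + 1) \ Z (m + 1) ⁻¹' (T : Set ℕ)) =
        avoidProb n T.card m * (1 - T.card / n) := by
      have : A (m + 1) \ Z (m + 1) ⁻¹' (T : Set ℕ) = A m ∩ Z (m + 1) ⁻¹' (T : Set ℕ)ᶜ := by
        ext ω
        simp only [hA, Set.mem_sdiff, Set.mem_inter_iff, Set.preimage_compl, Set.mem_compl_iff]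
        exact and_congr_left fun h => avoids_succ_iff_of_notMem (z := fun i => Z i ω) h
      rw [this, measureReal_inter_draw hZ hindep (fun z z' => avoids_congr T), hcompl, ih0]
    have hin : μ.real (A (m + 1) ∩ Z (m + 1) ⁻¹' (T : Set ℕ)) =
        avoidProb n T.card (m + 1) - avoidProb n T.card m * (1 - T.card / n) := by
      have := measureReal_inter_add_sdiff (μ := μ) (s := A (m + 1)) hmemT
      rw [hout] at this
      rw [← ih1]
      linarith
    -- Fixing the value of draw m + 1 turns the repetition into an event about draw m + 2 alone, so
    -- independence applies to each piece.
    set E : ℕ → Set Ω := fun j => A (m + 1) ∩ Z (m + 1) ⁻¹' {j} with hE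
    have hdisj : (T : Set ℕ).PairwiseDisjoint E := by
      intro a _ b _ hab
      refine Set.disjoint_left.2 fun ω ha hb => hab ?_
      exact ha.2.symm.trans hb.2
    have hsumE : ∑ j ∈ T, μ.real (E j) = μ.real (A (m + 1) ∩ Z (m + 1) ⁻¹' (T : Set ℕ)) := by
      rw [← measureReal_biUnion_finset hdisj fun j _ => (hAm _).inter (hZ _ .of_discrete)]
      congr 1
      ext ω
      simp [hE]
    have hbad : μ.real (A (m + 1) ∩ {ω | Z (m + 1) ω ∈ T ∧ Z (m + 2) ω = Z (m + 1) ω}) =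
        1 / n * μ.real (A (m + 1) ∩ Z (m + 1) ⁻¹' (T : Set ℕ)) := by
      have : A (m + 1) ∩ {ω | Z (m + 1) ω ∈ T ∧ Z (m + 2) ω = Z (m + 1) ω} =
          ⋃ j ∈ T, (E j ∩ Z (m + 2) ⁻¹' {j}) := by
        ext ω
        simp only [hE, Set.mem_inter_iff, Set.mem_ofPred_eq, Set.mem_iUnion, Set.mem_preimage,
          Set.mem_singleton_iff, exists_prop]
        constructor
        · rintro ⟨h1, h2, h3⟩
          exact ⟨_, h2, ⟨h1, rfl⟩, h3⟩
        · rintro ⟨j, hj, ⟨h1, h2⟩, h3⟩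
          exact ⟨h1, h2 ▸ hj, h3.trans h2.symm⟩
      rw [this, measureReal_biUnion_finset
        (hdisj.mono_on fun j _ => Set.inter_subset_left)
        fun j _ => ((hAm _).inter (hZ _ .of_discrete)).inter (hZ _ .of_discrete), ← hsumE,
        Finset.mul_sum]
      refine Finset.sum_congr rfl fun j hj => ?_
      have := measureReal_inter_draw hZ hindep (m := m + 1)
        (Q := fun z => Avoids T (m + 1) z ∧ z (m + 1) = j)
        (fun z z' h => and_congr (avoids_congr T h) (by rw [h (m + 1) (by omega) le_rfl])) {j}
      rw [hunif (m + 1 + 1) (by omega) j (hT hj), mul_comm] at this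
      exact this
    have hsplit : A (m + 2) =
        A (m + 1) \ {ω | Z (m + 1) ω ∈ T ∧ Z (m + 2) ω = Z (m + 1) ω} := by
      ext ω
      exact avoids_succ_succ_iff
    have hbadm : MeasurableSet {ω | Z (m + 1) ω ∈ T ∧ Z (m + 2) ω = Z (m + 1) ω} :=
      hmemT.inter (measurableSet_eq_fun (hZ _) (hZ _))
    have := measureReal_inter_add_sdiff (μ := μ) (s := A (m + 1)) hbadm
    rw [← hsplit, hbad, hin, ih1] at this
    rw [avoidProb, ← sub_eq_zero, ← sub_eq_zero.2 this]
    field_simp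
    ring

theorem integrable_indicator_avoids (hZ : ∀ i, Measurable (Z i)) (T : Finset ℕ) (m : ℕ) :
    Integrable ({ω | Avoids T m fun i => Z i ω}.indicator (1 : Ω → ℝ)) μ :=
  (integrable_const (1 : ℝ)).indicator (measurableSet_avoids hZ T m)

theorem integrable_choose_card_missing (hZ : ∀ i, Measurable (Z i)) (m r : ℕ) :
    Integrable (fun ω => ((missing n m fun i => Z i ω).card.choose r : ℝ)) μ := by
  rw [choose_card_missing_eq]
  exact integrable_finsetSum _ fun T _ => integrable_indicator_avoids hZ T m

theorem integral_choose_card_missing (hn : 1 ≤ n) (hZ : ∀ i, Measurable (Z i))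
    (hindep : iIndepFun (fun i => Z (i + 1)) μ)
    (hunif : ∀ i, 1 ≤ i → ∀ j ∈ Finset.Icc 1 n, μ.real (Z i ⁻¹' {j}) = 1 / n) (m r : ℕ) :
    ∫ ω, ((missing n m fun i => Z i ω).card.choose r : ℝ) ∂μ = n.choose r * avoidProb n r m := by
  rw [choose_card_missing_eq, integral_finsetSum _ fun T _ => integrable_indicator_avoids hZ T m]
  have : ∀ T ∈ (Finset.Icc 1 n).powersetCard r,
      ∫ ω, {ω | Avoids T m fun i => Z i ω}.indicator (1 : Ω → ℝ) ω ∂μ = avoidProb n r m := by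
    intro T hT
    rw [Finset.mem_powersetCard] at hT
    rw [integral_indicator_one (measurableSet_avoids hZ T m),
      measureReal_avoids hn hZ hindep hunif hT.1, hT.2]
  rw [Finset.sum_congr rfl this]
  simp

/-! ### Inclusion-exclusion for the number of missing pairs. -/

theorem alternating_sum_choose_mul_choose (s w N : ℕ) (hw : w ≤ N) :
    ∑ t ∈ Finset.range (N + 1), (-1 : ℝ) ^ t * (s + t).choose s * w.choose (s + t) =
      if w = s then 1 else 0 := by
  have hterm : ∀ t, (-1 : ℝ) ^ t * (s + t).choose s * w.choose (s + t) =
      w.choose s * ((-1 : ℝ) ^ t * (w - s).choose t) := by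
    intro t
    have h := Nat.choose_mul (n := w) (k := s + t) (s := s) (by omega)
    rw [Nat.add_sub_cancel_left] at h
    have h' : (w.choose (s + t) : ℝ) * (s + t).choose s = w.choose s * (w - s).choose t := by
      exact_mod_cast h
    linear_combination (-1 : ℝ) ^ t * h'
  rw [Finset.sum_congr rfl fun t _ => hterm t, ← Finset.mul_sum]
  have hsub : Finset.range (w - s + 1) ⊆ Finset.range (N + 1) :=
    Finset.range_subset_range.2 (by omega)
  rw [← Finset.sum_subset hsub fun t _ ht => by
    rw [Nat.choose_eq_zero_of_lt (by simpa using ht)]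
    simp]
  have h := Int.alternating_sum_range_choose (n := w - s)
  have h' : ∑ t ∈ Finset.range (w - s + 1), (-1 : ℝ) ^ t * (w - s).choose t =
      if w - s = 0 then 1 else 0 := by
    exact_mod_cast congrArg (Int.cast : ℤ → ℝ) h
  rw [h']
  -- For `w < s` truncated subtraction makes the inner sum 1, but the factor `w.choose s` vanishes.
  rcases lt_trichotomy w s with hlt | rfl | hlt
  · simp [Nat.choose_eq_zero_of_lt hlt, hlt.ne]
  · simp
  · have : w - s ≠ 0 := by omega
    simp [this, hlt.ne']

theorem card_missing_le (n m : ℕ) (z : ℕ → ℕ) : (missing n m z).card ≤ n := by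
  have := card_missing_add_numPairs n m z
  omega

theorem measurableSet_card_missing_eq (hZ : ∀ i, Measurable (Z i)) (m s : ℕ) :
    MeasurableSet {ω | (missing n m fun i => Z i ω).card = s} := by
  obtain ⟨S, hS⟩ := exists_preimage_eq_of_dependsOn (Q := fun z => (missing n m z).card = s) Z
    fun z z' h => by rw [missing_congr (m := m) n h]
  rw [hS]
  exact (measurable_pi_lambda _ fun i => hZ _) MeasurableSet.of_discrete

/-- Integrates the alternating binomial identity for the indicator of `W = s`. The sum is really
finite, since `n.choose (s + t)` vanishes for large `t`; as a `tsum` its index set is the same for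
all `n`, as dominated convergence requires. -/
theorem measureReal_card_missing_eq (hn : 1 ≤ n) (hZ : ∀ i, Measurable (Z i))
    (hindep : iIndepFun (fun i => Z (i + 1)) μ)
    (hunif : ∀ i, 1 ≤ i → ∀ j ∈ Finset.Icc 1 n, μ.real (Z i ⁻¹' {j}) = 1 / n) (m s : ℕ) :
    μ.real {ω | (missing n m fun i => Z i ω).card = s} =
      ∑' t : ℕ, (-1 : ℝ) ^ t * (s + t).choose s * (n.choose (s + t) * avoidProb n (s + t) m) := by
  rw [tsum_eq_sum (s := Finset.range (n + 1)) fun t ht => by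
    rw [Nat.choose_eq_zero_of_lt (n := n) (k := s + t) (by simp at ht; omega)]
    simp]
  rw [← integral_indicator_one (measurableSet_card_missing_eq hZ m s)]
  have : {ω | (missing n m fun i => Z i ω).card = s}.indicator (1 : Ω → ℝ) = fun ω =>
      ∑ t ∈ Finset.range (n + 1), (-1 : ℝ) ^ t * (s + t).choose s *
        ((missing n m fun i => Z i ω).card.choose (s + t) : ℝ) := by
    funext ω
    rw [alternating_sum_choose_mul_choose _ _ _ (card_missing_le n m _)]
    simp [Set.indicator_apply]
  rw [this, integral_finsetSum _ fun t _ =>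
    (integrable_choose_card_missing hZ m (s + t)).const_mul _]
  refine Finset.sum_congr rfl fun t _ => ?_
  rw [integral_const_mul, integral_choose_card_missing hn hZ hindep hunif]

theorem measureReal_card_missing_lt (hn : 1 ≤ n) (hZ : ∀ i, Measurable (Z i))
    (hindep : iIndepFun (fun i => Z (i + 1)) μ)
    (hunif : ∀ i, 1 ≤ i → ∀ j ∈ Finset.Icc 1 n, μ.real (Z i ⁻¹' {j}) = 1 / n) (m k : ℕ) :
    μ.real {ω | (missing n m fun i => Z i ω).card < k} = ∑ s ∈ Finset.range k,
      ∑' t : ℕ, (-1 : ℝ) ^ t * (s + t).choose s * (n.choose (s + t) * avoidProb n (s + t) m) := by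
  have : {ω | (missing n m fun i => Z i ω).card < k} =
      ⋃ s ∈ Finset.range k, {ω | (missing n m fun i => Z i ω).card = s} := by
    ext ω
    simp
  rw [this, measureReal_biUnion_finset _ fun s _ => measurableSet_card_missing_eq hZ m s]
  · exact Finset.sum_congr rfl fun s _ => measureReal_card_missing_eq hn hZ hindep hunif m s
  · intro a _ b _ hab
    exact Set.disjoint_left.2 fun ω ha hb => hab (ha.symm.trans hb)

end Probability

/-- The inclusion-exclusion formula for the distribution of the number of missing pairs. -/
theorem measureReal_card_missing_lt_of_hasLaw {Ω : Type*} [MeasurableSpace Ω] {μ : Measure Ω}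
    [IsProbabilityMeasure μ] {Z : ℕ → Ω → ℕ} {n : ℕ} (hn : 1 ≤ n)
    (hlaw : ∀ i, 1 ≤ i → HasLaw (Z i) (uniformOn (Set.Icc 1 n)) μ)
    (hindep : iIndepFun (fun i => Z (i + 1)) μ) (m k : ℕ) :
    μ.real {ω | (missing n m fun i => Z i ω).card < k} = ∑ s ∈ Finset.range k,
      ∑' t : ℕ, (-1 : ℝ) ^ t * (s + t).choose s * (n.choose (s + t) * avoidProb n (s + t) m) := by
  have hmeas : ∀ i, AEMeasurable (Z (i + 1)) μ := fun i => (hlaw (i + 1) (by omega)).aemeasurable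
  -- The laws give only a.e. measurability, so measurable versions replace the draws; draw 0 is
  -- unconstrained and never inspected, hence set to 0.
  let Y : ℕ → Ω → ℕ := fun i => Nat.casesOn i (fun _ => 0) fun i => (hmeas i).mk
  have hYZ : ∀ i, Z (i + 1) =ᵐ[μ] Y (i + 1) := fun i => (hmeas i).ae_eq_mk
  have hY : ∀ i, Measurable (Y i) := by
    rintro (_ | i)
    · exact measurable_const
    · exact (hmeas i).measurable_mk
  have hYunif : ∀ i, 1 ≤ i → ∀ j ∈ Finset.Icc 1 n, μ.real (Y i ⁻¹' {j}) = 1 / n := by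
    rintro (_ | i) hi j hj
    · omega
    · have hlawY := (hlaw (i + 1) hi).map_eq
      rw [Measure.map_congr (hYZ i)] at hlawY
      rw [measureReal_def, ← Measure.map_apply (μ := μ) (hY (i + 1)) (measurableSet_singleton j), hlawY]
      have := uniformOn_apply_finset (s := Finset.Icc 1 n) (t := {j})
      rw [Finset.inter_singleton_of_mem hj, Finset.coe_Icc, Finset.coe_singleton] at this
      rw [this]
      simp
  rw [← measureReal_card_missing_lt hn hY (hindep.congr hYZ) hYunif]
  refine measureReal_congr ?_
  filter_upwards [ae_all_iff.2 hYZ] with ω hω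
  have : missing n m (fun i => Z i ω) = missing n m (fun i => Y i ω) := by
    refine missing_congr n ?_
    rintro (_ | i) h1 -
    · omega
    · exact hω i
  exact congrArg (fun S : Finset ℕ => S.card < k) this

end PairCollector

/-! ### Poisson asymptotics at time n²(x + ln n). -/

namespace PairCollector

theorem avoidProb_le_exp_div_pow {n r : ℕ} (hn : 1 ≤ n) (hr : r ≤ n) {x : ℝ}
    (hx : 1 ≤ (n : ℝ) ^ 2 * (x + Real.log n)) :
    avoidProb n r ⌊(n : ℝ) ^ 2 * (x + Real.log n)⌋₊ ≤
      (Real.exp (-x + (x + Real.log n) / (n + 1) + 2 / (n * (n + 1))) / n) ^ r := by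
  have hn' : (1 : ℝ) ≤ n := by exact_mod_cast hn
  have hr' : (r : ℝ) ≤ n := by exact_mod_cast hr
  obtain ⟨m, hm⟩ : ∃ m, ⌊(n : ℝ) ^ 2 * (x + Real.log n)⌋₊ = m + 1 :=
    Nat.exists_eq_add_of_le' ((Nat.one_le_floor_iff _).2 hx)
  have hlt := Nat.lt_floor_add_one ((n : ℝ) ^ 2 * (x + Real.log n))
  rw [hm] at hlt ⊢
  push_cast at hlt
  have h0 : (0 : ℝ) ≤ 1 - (r : ℝ) / (n * (n + 1)) := by
    rw [sub_nonneg, div_le_one (by positivity)]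
    nlinarith
  refine (avoidProb_succ_le_pow hn hr m).trans ?_
  calc (1 - (r : ℝ) / (n * (n + 1))) ^ m
      ≤ Real.exp (-(r / (n * (n + 1)))) ^ m := by
        gcongr
        exact Real.one_sub_le_exp_neg _
    _ = Real.exp (-(m / (n * (n + 1)))) ^ r := by
        rw [← Real.exp_nat_mul, ← Real.exp_nat_mul]
        congr 1
        ring
    _ ≤ Real.exp (-x + (x + Real.log n) / (n + 1) + 2 / (n * (n + 1)) - Real.log n) ^ r := by
        gcongr
        -- The 2 pays for the floor and for the shifted index in the upper bound.
        have : -x + (x + Real.log n) / (n + 1) + 2 / (n * (n + 1)) - Real.log n =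
            -(((n : ℝ) ^ 2 * (x + Real.log n) - 2) / (n * (n + 1))) := by
          field_simp
          ring
        rw [this]
        gcongr
        linarith
    _ = _ := by rw [Real.exp_sub, Real.exp_log (by positivity)]

theorem exp_div_pow_le_avoidProb {n r : ℕ} (hr : r < n) {x : ℝ} (hx : 0 ≤ x + Real.log n) :
    (Real.exp (-x - r * ((x + Real.log n) / (n - r))) / n) ^ r ≤
      avoidProb n r ⌊(n : ℝ) ^ 2 * (x + Real.log n)⌋₊ := by
  have hn : 1 ≤ n := by omega
  have hn' : (1 : ℝ) ≤ n := by exact_mod_cast hn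
  have hr' : (r : ℝ) < n := by exact_mod_cast hr
  have hpos : (0 : ℝ) < n - r := sub_pos.2 hr'
  have hpos2 : (0 : ℝ) < n ^ 2 - r := by nlinarith
  set m := ⌊(n : ℝ) ^ 2 * (x + Real.log n)⌋₊ with hm
  have hle : (m : ℝ) ≤ (n : ℝ) ^ 2 * (x + Real.log n) := Nat.floor_le (by positivity)
  have h0 : (0 : ℝ) < 1 - (r : ℝ) / n ^ 2 := by
    rw [sub_pos, div_lt_one (by positivity)]
    linarith
  refine le_trans ?_ (pow_le_avoidProb hn hr.le m)
  calc (Real.exp (-x - r * ((x + Real.log n) / (n - r))) / n) ^ r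
      = Real.exp (-x - r * ((x + Real.log n) / (n - r)) - Real.log n) ^ r := by
        rw [Real.exp_sub _ (Real.log n), Real.exp_log (by positivity)]
    _ ≤ Real.exp (-(m / (n ^ 2 - r))) ^ r := by
        gcongr
        have h1 : (m : ℝ) / (n ^ 2 - r) ≤ (n : ℝ) ^ 2 * (x + Real.log n) / (n ^ 2 - r) := by
          gcongr
        have h2 : (n : ℝ) ^ 2 * (x + Real.log n) / (n ^ 2 - r) =
            (x + Real.log n) + r * ((x + Real.log n) / (n ^ 2 - r)) := by
          field_simp
          ring
        -- The weaker denominator n - r still gives a vanishing error and fits the limit of (x + ln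
        -- n)/(n + b).
        have h3 : (r : ℝ) * ((x + Real.log n) / (n ^ 2 - r)) ≤
            r * ((x + Real.log n) / (n - r)) := by
          gcongr
          nlinarith
        linarith
    _ = Real.exp (-(r / (n ^ 2 - r))) ^ m := by
        rw [← Real.exp_nat_mul, ← Real.exp_nat_mul]
        congr 1
        ring
    _ ≤ (1 - (r : ℝ) / n ^ 2) ^ m := by
        gcongr
        rw [← Real.le_log_iff_exp_le h0]
        refine le_trans (le_of_eq ?_) (Real.one_sub_inv_le_log_of_pos h0)
        have : 1 - (r : ℝ) / n ^ 2 = (n ^ 2 - r) / n ^ 2 := by field_simp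
        rw [this]
        field_simp
        ring

theorem tendsto_add_log_div_add_atTop (x b : ℝ) :
    Tendsto (fun n : ℕ => (x + Real.log n) / ((n : ℝ) + b)) atTop (𝓝 0) := by
  have h1 := (Real.tendsto_pow_log_div_mul_add_atTop 1 b 1 one_ne_zero).comp
    (tendsto_natCast_atTop_atTop (R := ℝ))
  have h0 := ((Real.tendsto_pow_log_div_mul_add_atTop 1 b 0 one_ne_zero).const_mul x).comp
    (tendsto_natCast_atTop_atTop (R := ℝ))
  simpa [Function.comp_def, div_eq_mul_inv, add_mul] using h0.add h1

theorem tendsto_upper_exponent (x : ℝ) :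
    Tendsto (fun n : ℕ => -x + (x + Real.log n) / ((n : ℝ) + 1) + 2 / ((n : ℝ) * (n + 1))) atTop
      (𝓝 (-x)) := by
  have h1 := tendsto_add_log_div_add_atTop x 1
  have h2 : Tendsto (fun n : ℕ => 2 / ((n : ℝ) * (n + 1))) atTop (𝓝 0) :=
    tendsto_const_nhds.div_atTop
      (tendsto_natCast_atTop_atTop.atTop_mul_atTop₀
        (tendsto_natCast_atTop_atTop.atTop_add tendsto_const_nhds))
  simpa using (h1.const_add (-x)).add h2

theorem tendsto_lower_exponent (x : ℝ) (r : ℕ) :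
    Tendsto (fun n : ℕ => -x - r * ((x + Real.log n) / ((n : ℝ) - r))) atTop (𝓝 (-x)) := by
  simpa [sub_eq_add_neg] using
    ((tendsto_add_log_div_add_atTop x (-r)).const_mul (r : ℝ)).const_sub (-x)

theorem eventually_le_sq_mul_add_log (x : ℝ) :
    ∀ᶠ n : ℕ in atTop, 1 ≤ n ∧ 0 ≤ x + Real.log n ∧ 1 ≤ (n : ℝ) ^ 2 * (x + Real.log n) := by
  have h : Tendsto (fun n : ℕ => x + Real.log n) atTop atTop :=
    tendsto_atTop_add_const_left _ _ (Real.tendsto_log_atTop.comp tendsto_natCast_atTop_atTop)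
  filter_upwards [eventually_ge_atTop 1, h.eventually_ge_atTop 1] with n hn hx
  have hn' : (1 : ℝ) ≤ n := by exact_mod_cast hn
  refine ⟨hn, by linarith, ?_⟩
  nlinarith [one_le_pow₀ hn' (n := 2)]

theorem tendsto_choose_mul_avoidProb (x : ℝ) (r : ℕ) :
    Tendsto (fun n : ℕ => n.choose r * avoidProb n r ⌊(n : ℝ) ^ 2 * (x + Real.log n)⌋₊) atTop
      (𝓝 (Real.exp (-x) ^ r / r.factorial)) := by
  have aux : ∀ e : ℕ → ℝ, Tendsto e atTop (𝓝 (-x)) →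
      Tendsto (fun n : ℕ => n.choose r * (Real.exp (e n) / n) ^ r) atTop
        (𝓝 (Real.exp (-x) ^ r / r.factorial)) := by
    intro e he
    refine tendsto_choose_mul_pow_atTop r (p := fun n => Real.exp (e n) / n) ?_
    refine ((Real.continuous_exp.tendsto _).comp he).congr' ?_
    filter_upwards [eventually_ge_atTop 1] with n hn
    have : (n : ℝ) ≠ 0 := by positivity
    simp only [Function.comp_apply]
    field_simp
  refine tendsto_of_tendsto_of_tendsto_of_le_of_le' (aux _ (tendsto_lower_exponent x r))
    (aux _ (tendsto_upper_exponent x)) ?_ ?_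
  · filter_upwards [eventually_le_sq_mul_add_log x, eventually_gt_atTop r] with n hn hr
    gcongr
    exact exp_div_pow_le_avoidProb hr hn.2.1
  · filter_upwards [eventually_le_sq_mul_add_log x, eventually_gt_atTop r] with n hn hr
    gcongr
    exact avoidProb_le_exp_div_pow hn.1 hr.le hn.2.2

/-- The exponent in the upper bound does not involve `r`, so a single threshold for `n`, past which
it is at most -x + 1, serves all `r`. This supplies the domination. -/
theorem eventually_choose_mul_avoidProb_le (x : ℝ) :
    ∀ᶠ n : ℕ in atTop, ∀ r,
      |n.choose r * avoidProb n r ⌊(n : ℝ) ^ 2 * (x + Real.log n)⌋₊| ≤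
        Real.exp (-x + 1) ^ r / r.factorial := by
  filter_upwards [eventually_le_sq_mul_add_log x,
    (tendsto_upper_exponent x).eventually_le_const (lt_add_one (-x))] with n hn he r
  rcases Nat.lt_or_ge n r with hr | hr
  · rw [Nat.choose_eq_zero_of_lt hr]
    simp only [Nat.cast_zero, zero_mul, abs_zero]
    positivity
  have hn' : (0 : ℝ) < n := by exact_mod_cast hn.1
  rw [abs_of_nonneg (mul_nonneg (Nat.cast_nonneg _) (avoidProb_nonneg hn.1 hr _))]
  calc n.choose r * avoidProb n r ⌊(n : ℝ) ^ 2 * (x + Real.log n)⌋₊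
      ≤ (n : ℝ) ^ r / r.factorial * (Real.exp (-x + 1) / n) ^ r := by
        gcongr
        · exact avoidProb_nonneg hn.1 hr _
        · exact Nat.choose_le_pow_div r n
        · exact (avoidProb_le_exp_div_pow hn.1 hr hn.2.2).trans (by gcongr)
    _ = _ := by
        rw [div_pow]
        field_simp

theorem tendsto_tsum_choose_mul_avoidProb (x : ℝ) (s : ℕ) :
    Tendsto (fun n : ℕ => ∑' t : ℕ, (-1 : ℝ) ^ t * (s + t).choose s *
        (n.choose (s + t) * avoidProb n (s + t) ⌊(n : ℝ) ^ 2 * (x + Real.log n)⌋₊)) atTop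
      (𝓝 (Real.exp (-Real.exp (-x)) * (Real.exp (-(s : ℝ) * x) / s.factorial))) := by
  have hlim : ∑' t : ℕ, (-1 : ℝ) ^ t * (s + t).choose s *
      (Real.exp (-x) ^ (s + t) / (s + t).factorial) =
      Real.exp (-Real.exp (-x)) * (Real.exp (-(s : ℝ) * x) / s.factorial) := by
    have hterm : ∀ t : ℕ, (-1 : ℝ) ^ t * (s + t).choose s *
        (Real.exp (-x) ^ (s + t) / (s + t).factorial) =
        (-Real.exp (-x)) ^ t / t.factorial * (Real.exp (-(s : ℝ) * x) / s.factorial) := by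
      intro t
      have h1 : ((s + t).choose s : ℝ) * (s.factorial * t.factorial) = (s + t).factorial := by
        have := Nat.add_choose_mul_factorial_mul_factorial s t
        rw [← Nat.choose_symm_add] at this
        rw [← mul_assoc]
        exact_mod_cast this
      have h2 : Real.exp (-(s : ℝ) * x) = Real.exp (-x) ^ s := by
        rw [← Real.exp_nat_mul]
        congr 1
        ring
      have h3 : ((s + t).choose s : ℝ) ≠ 0 :=
        Nat.cast_ne_zero.2 (Nat.choose_pos (by omega)).ne'
      rw [h2, ← h1, neg_pow (Real.exp (-x))]
      field_simp
      ring
    rw [tsum_congr hterm, tsum_mul_right, Real.exp_eq_exp_ℝ,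
      NormedSpace.exp_eq_tsum_div (𝔸 := ℝ)]
  rw [← hlim]
  refine tendsto_tsum_of_dominated_convergence
    -- The 2 absorbs `(s + t).choose s ≤ 2 ^ (s + t)`; the bound is a tail of an exponential series.
    (bound := fun t => (2 * Real.exp (-x + 1)) ^ (s + t) / (s + t).factorial) ?_ ?_ ?_
  · have := (summable_nat_add_iff s).2 (Real.summable_pow_div_factorial (2 * Real.exp (-x + 1)))
    simpa only [add_comm s] using this
  · exact fun t => (tendsto_choose_mul_avoidProb x (s + t)).const_mul _
  · filter_upwards [eventually_choose_mul_avoidProb_le x] with n hn t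
    rw [Real.norm_eq_abs, abs_mul, abs_mul, abs_pow, abs_neg, abs_one, one_pow, one_mul,
      Nat.abs_cast, mul_pow, mul_div_assoc]
    gcongr
    · exact_mod_cast Nat.choose_le_two_pow (s + t) s
    · exact hn (s + t)

theorem tendsto_measureReal_kthMaxTime
    {Ω : ℕ → Type*} [∀ n, MeasurableSpace (Ω n)]
    (P : (n : ℕ) → Measure (Ω n)) [∀ n, IsProbabilityMeasure (P n)]
    (Z : (n : ℕ) → ℕ → Ω n → ℕ)
    (hlaw : ∀ n, 1 ≤ n → ∀ i, 1 ≤ i → HasLaw (Z n i) (uniformOn (Set.Icc 1 n)) (P n))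
    (hindep : ∀ n, 1 ≤ n → iIndepFun (fun i : ℕ => Z n (i + 1)) (P n))
    {k : ℕ} (hk : 1 ≤ k) (x : ℝ) :
    Tendsto
      (fun n : ℕ => (P n).real {ω | TimeLE
        (kthMaxTime n k (fun i => Z n i ω)) ((n : ℝ) ^ 2 * (x + Real.log n))})
      atTop
      (𝓝 (Real.exp (-Real.exp (-x)) *
        ∑ s ∈ Finset.range k, Real.exp (-(s : ℝ) * x) / (s.factorial : ℝ))) := by
  rw [Finset.mul_sum]
  refine (tendsto_finsetSum (Finset.range k)
    fun s _ => tendsto_tsum_choose_mul_avoidProb x s).congr' ?_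
  filter_upwards [eventually_le_sq_mul_add_log x, eventually_ge_atTop k] with n hn hkn
  rw [← measureReal_card_missing_lt_of_hasLaw hn.1 (hlaw n hn.1) (hindep n hn.1)]
  congr 1
  ext ω
  exact (((timeLE_iff (by linarith [hn.2.2])).trans (kthMaxTime_le_iff hk hkn _ _))).symm

end PairCollector

theorem theorem3p3
    {Ω : ℕ → Type*} [∀ n, MeasurableSpace (Ω n)]
    (P : (n : ℕ) → Measure (Ω n)) [∀ n, IsProbabilityMeasure (P n)]
    (Z : (n : ℕ) → ℕ → Ω n → ℕ)
    (hlaw : ∀ n, 1 ≤ n → ∀ i, 1 ≤ i → HasLaw (Z n i) (uniformOn (Set.Icc 1 n)) (P n))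
    (hindep : ∀ n, 1 ≤ n → iIndepFun (fun i : ℕ => Z n (i + 1)) (P n))
    (k : ℕ) (hk : 1 ≤ k) :
    (∀ n, k ≤ n → ∀ ω : Ω n,
      PairCollector.collectTime n (n + 1 - k) (fun i => Z n i ω) =
        PairCollector.kthMaxTime n k (fun i => Z n i ω)) ∧
    (∀ x : ℝ, Tendsto
      (fun n : ℕ => (P n).real {ω | PairCollector.TimeLE
        (PairCollector.kthMaxTime n k (fun i => Z n i ω)) ((n : ℝ) ^ 2 * (x + Real.log n))})
      atTop
      (𝓝 (Real.exp (-Real.exp (-x)) *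
        ∑ s ∈ Finset.range k, Real.exp (-(s : ℝ) * x) / (s.factorial : ℝ)))) ∧
    (∀ n, 1 ≤ n → ∀ ω : Ω n,
      PairCollector.collectTime n n (fun i => Z n i ω) =
        PairCollector.maxTime n (fun i => Z n i ω)) ∧
    (∀ x : ℝ, Tendsto
      (fun n : ℕ => (P n).real {ω | PairCollector.TimeLE
        (PairCollector.maxTime n (fun i => Z n i ω)) ((n : ℝ) ^ 2 * (x + Real.log n))})
      atTop (𝓝 (Real.exp (-Real.exp (-x))))) := by
  refine ⟨fun n hkn ω => PairCollector.collectTime_eq_kthMaxTime hk hkn _,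
    PairCollector.tendsto_measureReal_kthMaxTime P Z hlaw hindep hk, fun n hn ω => ?_, fun x => ?_⟩
  · rw [← PairCollector.kthMaxTime_one hn, ← PairCollector.collectTime_eq_kthMaxTime le_rfl hn,
      Nat.add_sub_cancel]
  -- The case k = 1, where the Poisson sum reduces to its term s = 0.
  · have h := PairCollector.tendsto_measureReal_kthMaxTime P Z hlaw hindep le_rfl x
    simp only [Finset.range_one, Finset.sum_singleton, Nat.cast_zero, neg_zero, zero_mul,
      Real.exp_zero, Nat.factorial_zero, Nat.cast_one, div_one, mul_one] at h
    refine h.congr' ?_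
    filter_upwards [eventually_ge_atTop 1] with n hn
    simp only [PairCollector.kthMaxTime_one hn]
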